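/- **Setting (non-clairvoyant scheduling).** Time is discrete, $T\ge 2$ is the horizon and $m$ the number of machines. An instance $\mathcal J$ is a finite, totally ordered list of jobs, the order refining the order of arrival times. Job $j$ has an arrival time $a_j\in[T]$, a latest starting time (deadline) $d_j\in[a_j,a_j+d_{\max}]$ with $d_j\le T$, an integer length $l_j\in[0,\ell_{\max}]$ and a value per unit length $v_j\in[0,v_{\max}]$. A (deterministic, non-preemptive, online) mechanism decides at each time which waiting jobs to start, and at what price, knowing only the reports $(a_j,d_j,v_j)$ of the jobs that have arrived, its own past decisions, and the lengths of the jobs already completed. It is feasible if it never uses more than $m$ machines. $W_t$ is the sum of $v_j$ over the jobs processed at time $t$, and the welfare is $W=\sum_{t=1}^T W_t$. Put $L=\ell_{\max}+d_{\max}\ge 1$. **Restarts and switches.** At a restart at time $t$, the jobs that arrived before $t$ continue to be served by the run in progress; jobs arriving in $[t,t+L]$ have their arrival time set to $t+L+1$ (order and absolute deadlines are kept, and jobs whose deadline is then past are rejected); the later jobs are served by a fresh copy of the mechanism. A switch from $A$ to $B$ at time $t$ is the same, the fresh copy being one of $B$. For feasible mechanisms $A_1,\dots,A_n$ ($n\ge1$)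 and $\gamma\in[0,1]$, let $\overline{A_i}$ be $A_i$ restarted independently with probability $\gamma$ at every time $t\in[T]$. The random-restarting benchmark is $\overline{\mathrm{OPT}}(\mathcal J)=\max_{i}\mathbb E[W(\overline{A_i},\mathcal J)]$. **Bandit algorithm.** Let $\texttt{Bandit-ALG}$ be a randomized $n$-armed bandit algorithm that, without knowing the number of rounds $K$ or the range $R$ in advance, has regret at most $cR\sqrt{Kn\log n}$ for every $K$, every $R$ and every oblivious reward sequence with values in $[0,R]$. **FTBS.** Follow-The-Bandit-Switcher asks $\texttt{Bandit-ALG}$ for a first arm $i_1$ and runs $A_{i_1}$. At each $t\in[T]$ it flips an independent coin with heads probability $\gamma$. On heads, let $t'$ be the time of the previous heads ($t'=1$ if there is none). FTBS sends to $\texttt{Bandit-ALG}$ the reward $\sum_{x\in[t',t-1],\,x>t'+L}W_x(\mathrm{FTBS})$ for the current arm, receives the next arm, and switches at time $t$ to its mechanism, or restarts the current one if the arm is unchanged. On tails it continues. **Theorem.** Let $\gamma=(\ell_{\max}+d_{\max})^{-2/3}\,T^{-1/3}\,(n\log n)^{1/3}$, and assume $\gamma\le 1$. Then for every instance $\mathcal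 J$ $$\overline{\mathrm{OPT}}(\mathcal J)-\mathbb E[W(\mathrm{FTBS},\mathcal J)]\;\le\; C\cdot m\, v_{\max}\,(\ell_{\max}+d_{\max})^{1/3}\,(n\log n)^{1/3}\,T^{2/3}\log T ,$$ where the constant $C$ depends only on $c$. That is, the regret of FTBS relative to the random-restarting benchmark is $O\big(m\,v_{\max}(\ell_{\max}+d_{\max})^{1/3}(n\log n)^{1/3}T^{2/3}\log T\big)=\tilde O(T^{2/3})$. -/

import Mathlib

noncomputable section

namespace Sched

/-! ### Jobs, instances and non-clairvoyant mechanisms -/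

/-- A job. Time is discrete; `deadline` is the latest time at which the job may be started, `length`
is the number of consecutive time units it needs, `value` is the value per unit of length. -/
structure Job where
  arrival : ℕ
  deadline : ℕ
  length : ℕ
  value : ℝ

/-- The parameters of the scheduling problem: horizon `T`, number `m` of machines, maximal length,
maximal waiting time (deadline minus arrival) and maximal value per unit of length. -/
structure Params where
  T : ℕ
  m : ℕ
  lmax : ℕ
  dmax : ℕ
  vmax : ℝ

/-- The duration `ℓ_max + d_max` that governs restarts. -/
def Params.L (P : Params) : ℕ := P.lmax + P.dmax

/-- A finite list of jobs is an instance with parameters `P`. The list order is the total order of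
arrivals (ties in the arrival time are broken by the list order). -/
def IsInstance (P : Params) (J : List Job) : Prop :=
  J.Pairwise (fun j k => j.arrival ≤ k.arrival) ∧
  ∀ j ∈ J, 1 ≤ j.arrival ∧ j.arrival ≤ j.deadline ∧ j.deadline ≤ j.arrival + P.dmax ∧
    j.deadline ≤ P.T ∧ j.length ≤ P.lmax ∧ 0 ≤ j.value ∧ j.value ≤ P.vmax

/-- For each position in the list of jobs: `none` if the job has not been started, and
`some (s, p)` if it was started at time `s` at price `p` per unit of length. -/
abbrev Alloc := ℕ → Option (ℕ × ℝ)

/-- What a non-clairvoyant mechanism sees of an arrived job: its report (without the length), its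
allocation so far, and its length if the job has already been completed. -/
structure View where
  arrival : ℕ
  deadline : ℕ
  value : ℝ
  alloc : Option (ℕ × ℝ)
  length : Option ℕ

/-- The information available at time `t`: the views of the jobs that arrived by time `t`, in
arrival order. A job started at `s` occupies the times `s, …, s + length - 1`. -/
def observe (J : List Job) (σ : Alloc) (t : ℕ) : List View :=
  (J.mapIdx fun k j =>
    { arrival := j.arrival
      deadline := j.deadline
      value := j.value
      alloc := σ k
      length := (σ k).bind fun q => if q.1 + j.length ≤ t then some j.length else none : View }).filter
    fun w => w.arrival ≤ t

/-- A deterministic non-clairvoyant online mechanism: at each time `t`, from the information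
available at `t`, it decides for each waiting job (given by its position in the arrival order)
whether to start it now, and at which price per unit of length. Started jobs are not preempted. -/
structure Mechanism where
  decide : ℕ → List View → ℕ → Option ℝ

/-- The allocation after the decisions at the times `1, …, t`. A job can be started once, at a time
between its arrival and its deadline. -/
def Mechanism.run (A : Mechanism) (J : List Job) : ℕ → Alloc
  | 0 => fun _ => none
  | t + 1 => fun k =>
    match A.run J t k with
    | some q => some q
    | none =>
      match J[k]? with
      | none => none
      | some j =>
        if j.arrival ≤ t + 1 ∧ t + 1 ≤ j.deadline then
          (A.decide (t + 1) (observe J (A.run J t) (t + 1)) k).map fun p => (t + 1, p)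
        else none

open Classical in
/-- The jobs that are processed at time `t`. -/
def Mechanism.running (A : Mechanism) (J : List Job) (t : ℕ) : Finset (Fin J.length) :=
  Finset.univ.filter fun k => ∃ s p, A.run J t k = some (s, p) ∧ t < s + (J.get k).length

/-- The welfare `W_t(A, J)` generated at time `t`. -/
def Mechanism.welfareAt (A : Mechanism) (J : List Job) (t : ℕ) : ℝ :=
  ∑ k ∈ A.running J t, (J.get k).value

/-- The mechanism never uses more than `m` machines. -/
def Mechanism.Feasible (P : Params) (A : Mechanism) : Prop :=
  ∀ J, IsInstance P J → ∀ t, (A.running J t).card ≤ P.m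

/-! ### Restarts and switches

`S` is the set of times in `[T]` at which the coin shows heads. A restart at time `t` shifts the
jobs arriving in `[t, t + L]` to `t + L + 1`, keeps their absolute deadlines and rejects those whose
deadline has then passed; the jobs that arrived before `t` are finished by the run that was in
progress, and from `t + L + 1` on a fresh copy of a mechanism serves the later jobs. -/

/-- The arrival time of a job after the modifications of all restarts, in order of time. -/
def shiftedArrival (L : ℕ) (S : Finset ℕ) (a : ℕ) : ℕ :=
  (S.sort (· ≤ ·)).foldl (fun b t => if t ≤ b ∧ b ≤ t + L then t + L + 1 else b) a

/-- The index of the segment that contains time `t`: the number of heads up to time `t`. -/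
def segIdx (S : Finset ℕ) (t : ℕ) : ℕ := (S.filter (· ≤ t)).card

/-- The beginning of the segment that contains time `t ≥ 1`: the last heads up to time `t`, or time
`1` if there is none (heads occur at times `≥ 1` only). -/
def segStart (S : Finset ℕ) (t : ℕ) : ℕ := max 1 ((S.filter (· ≤ t)).sup id)

/-- The jobs, with modified arrival times, that are served by the copy started by the `x`-th heads
(for `x = 0`: the copy started at the beginning); rejected jobs are left out. -/
def segment (P : Params) (S : Finset ℕ) (J : List Job) (x : ℕ) : List Job :=
  (J.map fun j => { j with arrival := shiftedArrival P.L S j.arrival }).filter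
    fun j => j.arrival ≤ j.deadline ∧ segIdx S j.arrival = x

/-- The welfare at time `t` when a fresh copy of `A x` is run in segment `x`, for `x < K`. Every
job is served in at most one segment. If `A x = A (x + 1)` this restarts the mechanism, otherwise it
switches from `A x` to `A (x + 1)`. -/
def segmentedWelfareAt (P : Params) (S : Finset ℕ) (J : List Job) {K : ℕ}
    (A : Fin K → Mechanism) (t : ℕ) : ℝ :=
  ∑ x : Fin K, (A x).welfareAt (segment P S J x) t

/-- Total welfare `∑_{t = 1}^T W_t` for heads `S`, that is, with `#S + 1` segments. -/
def segmentedWelfare (P : Params) (S : Finset ℕ) (J : List Job)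
    (A : Fin (S.card + 1) → Mechanism) : ℝ :=
  ∑ t ∈ Finset.Icc 1 P.T, segmentedWelfareAt P S J A t

/-- Expectation over independent coins at the times `1, …, T`, each heads with probability `γ`;
`S` is the set of times that show heads. -/
def coinExp (T : ℕ) (γ : ℝ) (f : Finset ℕ → ℝ) : ℝ :=
  ∑ S ∈ (Finset.Icc 1 T).powerset, γ ^ S.card * (1 - γ) ^ (T - S.card) * f S

/-- The random-restarting benchmark: the best expected welfare of a candidate mechanism that is
restarted independently with probability `γ` at every time of `[T]`. -/
def benchmark (P : Params) (γ : ℝ) {n : ℕ} (A : Fin n → Mechanism) (J : List Job) : ℝ :=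
  ⨆ i : Fin n, coinExp P.T γ fun S => segmentedWelfare P S J fun _ => A i

/-! ### Bandit algorithms -/

/-- A randomized bandit algorithm with `n` arms: the distribution of the next arm, given the arms
played in the first `k` rounds and the rewards received for them. -/
structure BanditAlg (n : ℕ) where
  next : (k : ℕ) → (Fin k → Fin n) → (Fin k → ℝ) → PMF (Fin n)

/-- The first `k + 1` entries of a sequence. -/
def upTo {n K : ℕ} (a : Fin K → Fin n) (k : Fin K) : Fin (k.val + 1) → Fin n :=
  fun j => a ⟨j.val, by omega⟩

/-- The law of the first `K` arms when the reward received in round `k` is `fb k` of the arms played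
in the rounds `0, …, k`. -/
def BanditAlg.play {n : ℕ} (B : BanditAlg n) (fb : (k : ℕ) → (Fin (k + 1) → Fin n) → ℝ) :
    (K : ℕ) → PMF (Fin K → Fin n)
  | 0 => PMF.pure Fin.elim0
  | K + 1 => (B.play fb K).bind fun a =>
      (B.next K a fun k => fb k (upTo a k)).map fun i => Fin.snoc (α := fun _ => Fin n) a i

/-- Expectation of a function of the arms. -/
def armExp {n K : ℕ} (p : PMF (Fin K → Fin n)) (f : (Fin K → Fin n) → ℝ) : ℝ :=
  ∑ a, (p a).toReal * f a

/-- Against every oblivious sequence of rewards in `[0, R]`, for every `R` and every number of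
rounds `K` (neither of which the algorithm knows), the regret is at most `c R √(K n log n)`. -/
def BanditAlg.HasRegret {n : ℕ} (B : BanditAlg n) (c : ℝ) : Prop :=
  ∀ (K : ℕ) (R : ℝ) (r : ℕ → Fin n → ℝ), (∀ k i, 0 ≤ r k i ∧ r k i ≤ R) → ∀ i : Fin n,
    ∑ k : Fin K, r k i -
      armExp (B.play (fun k a => r k (a (Fin.last k))) K) (fun a => ∑ k : Fin K, r k (a k)) ≤
    c * R * √((K : ℝ) * n * Real.log n)

/-! ### Follow-The-Bandit-Switcher -/

/-- The feedback for the arm of segment `k`, sent at the heads that end the segment: the welfare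
generated by FTBS in the segment, where the times up to `segStart + L` count as `0`. The
argument `a` lists the arms followed in the segments `0, …, k`. -/
def ftbsFeedback (P : Params) {n : ℕ} (A : Fin n → Mechanism) (S : Finset ℕ) (J : List Job)
    (k : ℕ) (a : Fin (k + 1) → Fin n) : ℝ :=
  ∑ t ∈ (Finset.Icc 1 P.T).filter (fun t => segIdx S t = k),
    if t ≤ segStart S t + P.L then 0 else segmentedWelfareAt P S J (fun x => A (a x)) t

/-- The law, for heads `S`, of the arms that FTBS follows in its `#S + 1` segments. -/
def ftbsArms (P : Params) {n : ℕ} (A : Fin n → Mechanism) (B : BanditAlg n) (S : Finset ℕ)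
    (J : List Job) : PMF (Fin (S.card + 1) → Fin n) :=
  B.play (ftbsFeedback P A S J) (S.card + 1)

/-- The expected welfare of FTBS, over the coins and the randomness of the bandit algorithm. -/
def ftbsWelfare (P : Params) (γ : ℝ) {n : ℕ} (A : Fin n → Mechanism) (B : BanditAlg n)
    (J : List Job) : ℝ :=
  coinExp P.T γ fun S =>
    armExp (ftbsArms P A B S J) fun a => segmentedWelfare P S J fun x => A (a x)

/-- The restart probability `(ℓ_max + d_max)^{-2/3} T^{-1/3} (n log n)^{1/3}`. -/
def restartProb (P : Params) (n : ℕ) : ℝ :=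
  (P.L : ℝ) ^ (-(2 / 3) : ℝ) * (P.T : ℝ) ^ (-(1 / 3) : ℝ) *
    ((n : ℝ) * Real.log n) ^ (1 / 3 : ℝ)

end Sched

end

/-! Couple FTBS with the restarted `A i` through the same set `S` of heads and condition on `S`. A
job runs less than `L` time units past its arrival, so after the first `L + 1` times of a segment
only jobs served by the fresh copy are running. Their welfare depends on `S`, the instance and the
current arm, but not on earlier arms (`ftbsFeedback_eq`). Hence, for fixed `S`, the bandit faces an
oblivious reward sequence with `S.card + 1` rounds, and its regret guarantee applies
(`armExp_ftbs_ge`). It must not know `K` and `R` beforehand, because both depend on the coins.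

Two losses remain, in units of `m * vmax`. Ignoring the warm-ups costs at most `(S.card + 1) * (L +
1)`. The bandit regret is of order `g * √((S.card + 1) * n log n)` if no segment is longer than `g`;
a union bound over windows without heads controls the other coin outcomes, where the trivial loss
`T` is charged. With `q = n log n` and `g ≈ 2 log T / γ`, the expected losses are of order `γ L T`
and `log T * √(T q / γ)`; the chosen `γ` makes `γ L T` and `√(T q / γ)` both equal to `X = L^{1/3}
q^{1/3} T^{2/3}`. -/

namespace Sched

/-! ### Shifted arrival times and segments -/

/-- The effect of one restart at time `h` on the arrival time `b`. -/
def shiftStep (L b h : ℕ) : ℕ := if h ≤ b ∧ b ≤ h + L then h + L + 1 else b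

theorem le_shiftStep (L b h : ℕ) : b ≤ shiftStep L b h := by
  unfold shiftStep; split_ifs <;> omega

theorem shiftStep_mono (L h : ℕ) {a b : ℕ} (hab : a ≤ b) :
    shiftStep L a h ≤ shiftStep L b h := by
  unfold shiftStep; split_ifs <;> omega

theorem le_foldl_shiftStep (L : ℕ) (l : List ℕ) (a : ℕ) : a ≤ l.foldl (shiftStep L) a := by
  induction l generalizing a with
  | nil => simp
  | cons h l ih => exact (le_shiftStep L a h).trans (ih _)

theorem foldl_shiftStep_mono (L : ℕ) (l : List ℕ) {a b : ℕ} (hab : a ≤ b) :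
    l.foldl (shiftStep L) a ≤ l.foldl (shiftStep L) b := by
  induction l generalizing a b with
  | nil => simpa
  | cons h l ih => exact ih (shiftStep_mono L h hab)

theorem foldl_shiftStep_eq (L : ℕ) (l : List ℕ) (a : ℕ) (hl : ∀ h ∈ l, a < h) :
    l.foldl (shiftStep L) a = a := by
  induction l with
  | nil => rfl
  | cons h l ih =>
    have h1 : shiftStep L a h = a := by
      have := hl h (by simp)
      unfold shiftStep; split_ifs <;> omega
    rw [List.foldl_cons, h1]
    exact ih fun x hx => hl x (by simp [hx])

/-- Just after head `x` is processed, the arrival is before `x` or beyond `x + L`. In the first case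
it is also before all later heads, since these are sorted, and never moves again; in the second it
can only grow. -/
theorem foldl_shiftStep_avoids (L : ℕ) (l : List ℕ) (hl : l.Pairwise (· ≤ ·)) (a : ℕ) :
    ∀ h ∈ l, l.foldl (shiftStep L) a < h ∨ h + L < l.foldl (shiftStep L) a := by
  induction l generalizing a with
  | nil => simp
  | cons h l ih =>
    rw [List.pairwise_cons] at hl
    intro x hx
    rw [List.foldl_cons]
    rcases List.mem_cons.1 hx with rfl | hx
    · by_cases hb : shiftStep L a x < x
      · left
        rwa [foldl_shiftStep_eq L l _ fun y hy => lt_of_lt_of_le hb (hl.1 y hy)]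
      · right
        refine lt_of_lt_of_le ?_ (le_foldl_shiftStep L l _)
        unfold shiftStep at hb ⊢
        split_ifs at hb ⊢ <;> omega
    · exact ih hl.2 _ x hx

theorem le_shiftedArrival (L : ℕ) (S : Finset ℕ) (a : ℕ) : a ≤ shiftedArrival L S a :=
  le_foldl_shiftStep L _ a

theorem shiftedArrival_mono (L : ℕ) (S : Finset ℕ) {a b : ℕ} (hab : a ≤ b) :
    shiftedArrival L S a ≤ shiftedArrival L S b :=
  foldl_shiftStep_mono L _ hab

theorem shiftedArrival_avoids (L : ℕ) (S : Finset ℕ) (a : ℕ) {h : ℕ} (hh : h ∈ S) :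
    shiftedArrival L S a < h ∨ h + L < shiftedArrival L S a :=
  foldl_shiftStep_avoids L _ (Finset.pairwise_sort S (· ≤ ·)) a h (by simpa using hh)

theorem segIdx_mono (S : Finset ℕ) {s t : ℕ} (h : s ≤ t) : segIdx S s ≤ segIdx S t :=
  Finset.card_le_card fun x hx => by
    simp only [Finset.mem_filter] at hx ⊢
    exact ⟨hx.1, hx.2.trans h⟩

theorem segIdx_le_card (S : Finset ℕ) (t : ℕ) : segIdx S t ≤ S.card :=
  Finset.card_filter_le _ _

theorem exists_head_of_segIdx_lt {S : Finset ℕ} {s t : ℕ} (h : segIdx S s < segIdx S t) :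
    ∃ x ∈ S, s < x ∧ x ≤ t := by
  by_contra! hc
  refine absurd (Finset.card_le_card (fun x hx => ?_)) (not_le.2 h)
  simp only [Finset.mem_filter] at hx ⊢
  refine ⟨hx.1, ?_⟩
  by_contra! hs
  exact absurd hx.2 (not_le.2 (hc x hx.1 hs))

theorem segIdx_lt_of_head {S : Finset ℕ} {s t x : ℕ} (hx : x ∈ S) (hs : s < x) (ht : x ≤ t) :
    segIdx S s < segIdx S t := by
  refine Finset.card_lt_card ⟨fun y hy => ?_, fun hsub => ?_⟩
  · simp only [Finset.mem_filter] at hy ⊢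
    exact ⟨hy.1, by omega⟩
  · have := hsub (show x ∈ S.filter (· ≤ t) by simp [hx, ht])
    simp only [Finset.mem_filter] at this
    omega

theorem le_segStart {S : Finset ℕ} {t x : ℕ} (hx : x ∈ S) (hxt : x ≤ t) : x ≤ segStart S t :=
  le_max_of_le_right (Finset.le_sup (f := id) (show x ∈ S.filter (· ≤ t) by simp [hx, hxt]))

theorem segStart_le {S : Finset ℕ} {t : ℕ} (ht : 1 ≤ t) : segStart S t ≤ t :=
  max_le ht (Finset.sup_le fun _ hx => (Finset.mem_filter.1 hx).2)

theorem segStart_mem (S : Finset ℕ) (t : ℕ) : segStart S t ∈ insert 1 S := by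
  unfold segStart
  rcases (S.filter (· ≤ t)).eq_empty_or_nonempty with h | h
  · simp [h]
  · obtain ⟨x, hx, hxs⟩ := Finset.exists_mem_eq_sup _ h id
    rw [hxs]
    rcases max_choice 1 (id x) with h1 | h1 <;> rw [h1]
    · simp
    · exact Finset.mem_insert_of_mem (Finset.mem_filter.1 hx).1

theorem mem_segment {P : Params} {S : Finset ℕ} {J : List Job} (hJ : IsInstance P J) {x : ℕ}
    {j : Job} (hj : j ∈ segment P S J x) :
    1 ≤ j.arrival ∧ j.arrival ≤ j.deadline ∧ j.deadline ≤ j.arrival + P.dmax ∧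
      j.deadline ≤ P.T ∧ j.length ≤ P.lmax ∧ 0 ≤ j.value ∧ j.value ≤ P.vmax ∧
      segIdx S j.arrival = x ∧ ∀ h ∈ S, j.arrival < h ∨ h + P.L < j.arrival := by
  simp only [segment, List.mem_filter, List.mem_map, decide_eq_true_eq] at hj
  obtain ⟨⟨i, hi, rfl⟩, h1, h2⟩ := hj
  obtain ⟨b1, -, b3, b4, b5, b6, b7⟩ := hJ.2 i hi
  have hle := le_shiftedArrival P.L S i.arrival
  exact ⟨b1.trans hle, h1, b3.trans (by simpa using hle), b4, b5, b6, b7, h2,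
    fun h hh => shiftedArrival_avoids P.L S _ hh⟩

/-- Delaying arrivals while keeping deadlines only shortens waiting times, and monotonicity of the
shift keeps the order. Feasibility can thus be applied to each segment separately. -/
theorem isInstance_segment {P : Params} (S : Finset ℕ) {J : List Job} (hJ : IsInstance P J)
    (x : ℕ) : IsInstance P (segment P S J x) := by
  refine ⟨?_, fun j hj => ?_⟩
  · refine List.Pairwise.filter _ (List.pairwise_map.2 (hJ.1.imp ?_))
    exact fun h => shiftedArrival_mono P.L S h
  · obtain ⟨h1, h2, h3, h4, h5, h6, h7, -⟩ := mem_segment hJ hj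
    exact ⟨h1, h2, h3, h4, h5, h6, h7⟩

/-! ### Welfare at a time -/

theorem Mechanism.run_eq_some (A : Mechanism) (J : List Job) (t k s : ℕ) (p : ℝ)
    (h : A.run J t k = some (s, p)) :
    ∃ j, J[k]? = some j ∧ j.arrival ≤ s ∧ s ≤ j.deadline ∧ s ≤ t := by
  induction t with
  | zero => simp [Mechanism.run] at h
  | succ t ih =>
    rw [Mechanism.run] at h
    dsimp only at h
    split at h
    · next q hq =>
      obtain ⟨j, h1, h2, h3, h4⟩ := ih (hq.trans h)
      exact ⟨j, h1, h2, h3, by omega⟩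
    · split at h
      · simp at h
      · next j hj =>
        split_ifs at h with hc
        rw [Option.map_eq_some_iff] at h
        obtain ⟨p', -, h2⟩ := h
        rw [Prod.mk.injEq] at h2
        exact ⟨j, hj, by omega, by omega, by omega⟩

theorem Mechanism.of_mem_running {A : Mechanism} {J : List Job} {t : ℕ} {k : Fin J.length}
    (h : k ∈ A.running J t) :
    (J.get k).arrival ≤ t ∧ t < (J.get k).deadline + (J.get k).length := by
  simp only [Mechanism.running, Finset.mem_filter, Finset.mem_univ, true_and] at h
  obtain ⟨s, p, h1, h2⟩ := h
  obtain ⟨j, h3, h4, h5, h6⟩ := A.run_eq_some J t k s p h1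
  have : j = J.get k := by
    rw [List.getElem?_eq_getElem k.2] at h3
    simpa using h3.symm
  subst this
  omega

theorem welfareAt_nonneg {P : Params} {J : List Job} (hJ : IsInstance P J) (A : Mechanism)
    (t : ℕ) : 0 ≤ A.welfareAt J t :=
  Finset.sum_nonneg fun k _ => (hJ.2 _ (List.get_mem J k)).2.2.2.2.2.1

theorem welfareAt_le {P : Params} {J : List Job} (hJ : IsInstance P J) {A : Mechanism}
    (hv : 0 ≤ P.vmax) (hA : A.Feasible P) (t : ℕ) : A.welfareAt J t ≤ P.m * P.vmax := by
  refine (Finset.sum_le_card_nsmul _ _ P.vmax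
    fun k _ => (hJ.2 _ (List.get_mem J k)).2.2.2.2.2.2).trans ?_
  rw [nsmul_eq_mul]
  exact mul_le_mul_of_nonneg_right (by exact_mod_cast hA J hJ t) hv

/-- A job starts at most `dmax` after its modified arrival and then runs for at most `lmax`, so
activity at `t` forces an arrival in `(t - L, t]`. -/
theorem exists_job_of_welfareAt_ne_zero {P : Params} {S : Finset ℕ} {J : List Job}
    (hJ : IsInstance P J) {A : Mechanism} {x t : ℕ}
    (h : A.welfareAt (segment P S J x) t ≠ 0) :
    ∃ a ≤ t, t < a + P.L ∧ segIdx S a = x ∧ ∀ h ∈ S, a < h ∨ h + P.L < a := by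
  obtain ⟨k, hk, -⟩ := Finset.exists_ne_zero_of_sum_ne_zero h
  have h1 := Mechanism.of_mem_running hk
  obtain ⟨-, -, h3, -, h5, -, -, h8, h9⟩ := mem_segment hJ (List.get_mem (segment P S J x) k)
  refine ⟨_, h1.1, ?_, h8, h9⟩
  have : P.L = P.lmax + P.dmax := rfl
  omega

/-- At each time, jobs of at most one segment are processed. -/
theorem segment_eq_of_welfareAt_ne_zero {P : Params} {S : Finset ℕ} {J : List Job}
    (hJ : IsInstance P J) {A B : Mechanism} {x y t : ℕ}
    (hx : A.welfareAt (segment P S J x) t ≠ 0) (hy : B.welfareAt (segment P S J y) t ≠ 0) :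
    x = y := by
  obtain ⟨a, ha, hat, rfl, hax⟩ := exists_job_of_welfareAt_ne_zero hJ hx
  obtain ⟨b, hb, hbt, rfl, hbx⟩ := exists_job_of_welfareAt_ne_zero hJ hy
  rcases lt_trichotomy (segIdx S a) (segIdx S b) with h | h | h
  -- A head `z` with `a < z ≤ b` pushes `b` beyond `z + L > a + L > t`, contradicting `b ≤ t`.
  · obtain ⟨z, hz, h1, h2⟩ := exists_head_of_segIdx_lt h
    have := hbx z hz
    omega
  · exact h
  · obtain ⟨z, hz, h1, h2⟩ := exists_head_of_segIdx_lt h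
    have := hax z hz
    omega

/-- After the warm-up of a segment, only jobs of that segment are processed. -/
theorem segment_eq_segIdx {P : Params} {S : Finset ℕ} {J : List Job} (hJ : IsInstance P J)
    {A : Mechanism} {x t : ℕ} (ht : segStart S t + P.L < t)
    (hx : A.welfareAt (segment P S J x) t ≠ 0) : x = segIdx S t := by
  obtain ⟨a, ha, hat, rfl, -⟩ := exists_job_of_welfareAt_ne_zero hJ hx
  refine (segIdx_mono S ha).eq_of_not_lt fun h => ?_
  obtain ⟨z, hz, h1, h2⟩ := exists_head_of_segIdx_lt h
  have := le_segStart hz h2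
  omega

theorem segmentedWelfareAt_nonneg {P : Params} (S : Finset ℕ) {J : List Job}
    (hJ : IsInstance P J) {K : ℕ} (A : Fin K → Mechanism) (t : ℕ) :
    0 ≤ segmentedWelfareAt P S J A t :=
  Finset.sum_nonneg fun x _ => welfareAt_nonneg (isInstance_segment S hJ x) _ _

/-- Feasibility bounds each copy alone; the bound has no factor `K` because at most one summand is
nonzero. -/
theorem segmentedWelfareAt_le {P : Params} (S : Finset ℕ) {J : List Job}
    (hJ : IsInstance P J) (hv : 0 ≤ P.vmax) {K : ℕ} {A : Fin K → Mechanism}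
    (hA : ∀ x, (A x).Feasible P) (t : ℕ) :
    segmentedWelfareAt P S J A t ≤ P.m * P.vmax := by
  by_cases h : ∃ x, (A x).welfareAt (segment P S J x) t ≠ 0
  · obtain ⟨x, hx⟩ := h
    unfold segmentedWelfareAt
    rw [Finset.sum_eq_single x]
    · exact welfareAt_le (isInstance_segment S hJ x) hv (hA x) t
    · intro y _ hy
      by_contra hne
      exact hy (Fin.ext (segment_eq_of_welfareAt_ne_zero hJ hne hx))
    · simp
  · push Not at h
    rw [segmentedWelfareAt, Finset.sum_eq_zero fun x _ => h x]
    positivity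

theorem segmentedWelfareAt_eq {P : Params} (S : Finset ℕ) {J : List Job}
    (hJ : IsInstance P J) {K : ℕ} (A : Fin K → Mechanism) {t : ℕ}
    (ht : segStart S t + P.L < t) (x : Fin K) (hx : segIdx S t = x) :
    segmentedWelfareAt P S J A t = (A x).welfareAt (segment P S J x) t := by
  unfold segmentedWelfareAt
  refine Finset.sum_eq_single x (fun y _ hy => ?_) (by simp)
  by_contra hne
  exact hy (Fin.ext ((segment_eq_segIdx hJ ht hne).trans hx))

/-! ### Segment rewards and warm-up losses -/

/-- The reward of arm `i` in segment `k`. -/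
noncomputable def segReward (P : Params) {n : ℕ} (A : Fin n → Mechanism) (S : Finset ℕ) (J : List Job)
    (k : ℕ) (i : Fin n) : ℝ :=
  ∑ t ∈ (Finset.Icc 1 P.T).filter (fun t => segIdx S t = k),
    if t ≤ segStart S t + P.L then 0 else (A i).welfareAt (segment P S J k) t

/-- This is obliviousness: leftover jobs of earlier arms can only run during the warm-up, which the
feedback counts as zero. -/
theorem ftbsFeedback_eq {P : Params} {n : ℕ} (A : Fin n → Mechanism) (S : Finset ℕ)
    {J : List Job} (hJ : IsInstance P J) (k : ℕ) (a : Fin (k + 1) → Fin n) :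
    ftbsFeedback P A S J k a = segReward P A S J k (a (Fin.last k)) := by
  refine Finset.sum_congr rfl fun t ht => ?_
  split_ifs with h
  · rfl
  · exact segmentedWelfareAt_eq S hJ _ (not_le.1 h) (Fin.last k) (Finset.mem_filter.1 ht).2

theorem sum_segReward {P : Params} {n : ℕ} (A : Fin n → Mechanism) (S : Finset ℕ)
    {J : List Job} (hJ : IsInstance P J) (a : Fin (S.card + 1) → Fin n) :
    ∑ k : Fin (S.card + 1), segReward P A S J k (a k) =
      ∑ t ∈ Finset.Icc 1 P.T, if t ≤ segStart S t + P.L then 0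
        else segmentedWelfareAt P S J (fun x => A (a x)) t := by
  let φ : ℕ → Fin (S.card + 1) := fun t => ⟨segIdx S t, Nat.lt_succ_of_le (segIdx_le_card S t)⟩
  rw [← Finset.sum_fiberwise (Finset.Icc 1 P.T) φ]
  refine Finset.sum_congr rfl fun k _ => ?_
  have hf : (Finset.Icc 1 P.T).filter (fun t => φ t = k) =
      (Finset.Icc 1 P.T).filter (fun t => segIdx S t = k) :=
    Finset.filter_congr fun t _ => by simp [φ, Fin.ext_iff]
  rw [hf]
  refine Finset.sum_congr rfl fun t ht => ?_
  split_ifs with h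
  · rfl
  · exact (segmentedWelfareAt_eq S hJ (fun x => A (a x)) (not_le.1 h) k
      (Finset.mem_filter.1 ht).2).symm

/-- Warm-up times are covered by the windows `[h, h + L]` with `h` a head or `h = 1`, the default
start of the initial segment. -/
theorem card_warmup_le (P : Params) (S : Finset ℕ) :
    ((Finset.Icc 1 P.T).filter fun t => t ≤ segStart S t + P.L).card ≤
      (S.card + 1) * (P.L + 1) := by
  calc _ ≤ ((insert 1 S).biUnion fun h => Finset.Icc h (h + P.L)).card := by
        refine Finset.card_le_card fun t ht => ?_
        simp only [Finset.mem_filter, Finset.mem_Icc] at ht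
        refine Finset.mem_biUnion.2 ⟨segStart S t, segStart_mem S t, ?_⟩
        exact Finset.mem_Icc.2 ⟨segStart_le ht.1.1, ht.2⟩
    _ ≤ (insert 1 S).card * (P.L + 1) :=
        Finset.card_biUnion_le_card_mul _ _ _ fun h _ => by simp; omega
    _ ≤ _ := Nat.mul_le_mul_right _ (Finset.card_insert_le _ _)

theorem segmentedWelfare_le {P : Params} (S : Finset ℕ) {J : List Job} (hJ : IsInstance P J)
    (hv : 0 ≤ P.vmax) {n : ℕ} {A : Fin n → Mechanism} (hA : ∀ i, (A i).Feasible P)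
    (a : Fin (S.card + 1) → Fin n) :
    segmentedWelfare P S J (fun x => A (a x)) ≤
      (S.card + 1) * (P.L + 1) * (P.m * P.vmax) +
        ∑ k : Fin (S.card + 1), segReward P A S J k (a k) := by
  have hmv : 0 ≤ (P.m : ℝ) * P.vmax := by positivity
  rw [sum_segReward A S hJ]
  calc segmentedWelfare P S J (fun x => A (a x))
      ≤ ∑ t ∈ Finset.Icc 1 P.T, ((if t ≤ segStart S t + P.L then P.m * P.vmax else 0) +
          if t ≤ segStart S t + P.L then 0
            else segmentedWelfareAt P S J (fun x => A (a x)) t) := by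
        refine Finset.sum_le_sum fun t _ => ?_
        split_ifs
        · simpa using segmentedWelfareAt_le S hJ hv (fun x => hA (a x)) t
        · simp
    _ ≤ _ := by
        rw [Finset.sum_add_distrib, ← Finset.sum_filter, Finset.sum_const, nsmul_eq_mul]
        gcongr
        exact_mod_cast card_warmup_le P S

theorem sum_segReward_le {P : Params} (S : Finset ℕ) {J : List Job} (hJ : IsInstance P J)
    {n : ℕ} (A : Fin n → Mechanism) (a : Fin (S.card + 1) → Fin n) :
    ∑ k : Fin (S.card + 1), segReward P A S J k (a k) ≤
      segmentedWelfare P S J (fun x => A (a x)) := by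
  rw [sum_segReward A S hJ]
  refine Finset.sum_le_sum fun t _ => ?_
  split_ifs
  · exact segmentedWelfareAt_nonneg S hJ _ t
  · rfl

theorem segmentedWelfare_nonneg {P : Params} (S : Finset ℕ) {J : List Job}
    (hJ : IsInstance P J) (A : Fin (S.card + 1) → Mechanism) : 0 ≤ segmentedWelfare P S J A :=
  Finset.sum_nonneg fun t _ => segmentedWelfareAt_nonneg S hJ A t

theorem segmentedWelfare_le_horizon {P : Params} (S : Finset ℕ) {J : List Job}
    (hJ : IsInstance P J) (hv : 0 ≤ P.vmax) {A : Fin (S.card + 1) → Mechanism}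
    (hA : ∀ x, (A x).Feasible P) : segmentedWelfare P S J A ≤ P.T * (P.m * P.vmax) := by
  refine (Finset.sum_le_card_nsmul _ _ _
    fun t _ => segmentedWelfareAt_le S hJ hv hA t).trans ?_
  simp [nsmul_eq_mul]

theorem segReward_nonneg {P : Params} (S : Finset ℕ) {J : List Job} (hJ : IsInstance P J)
    {n : ℕ} (A : Fin n → Mechanism) (k : ℕ) (i : Fin n) : 0 ≤ segReward P A S J k i :=
  Finset.sum_nonneg fun t _ => by
    split_ifs
    · rfl
    · exact welfareAt_nonneg (isInstance_segment S hJ k) _ _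

/-- If the heads hit every window of `g` consecutive times, every segment has at most `g` times. -/
theorem card_segment_times_le {T g : ℕ} (S : Finset ℕ)
    (hg : ∀ u ∈ Finset.Icc 1 T, u + g ≤ T + 1 → ∃ h ∈ S, u ≤ h ∧ h < u + g) (k : ℕ) :
    ((Finset.Icc 1 T).filter fun t => segIdx S t = k).card ≤ g := by
  set F := (Finset.Icc 1 T).filter fun t => segIdx S t = k with hF
  rcases F.eq_empty_or_nonempty with h | h
  · simp [h]
  · have hmin := F.min'_mem h
    set u := F.min' h
    have hsub : F ⊆ Finset.Ico u (u + g) := by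
      intro t ht
      have hut : u ≤ t := F.min'_le t ht
      refine Finset.mem_Ico.2 ⟨hut, ?_⟩
      by_contra! hc
      simp only [hF, Finset.mem_filter, Finset.mem_Icc] at ht hmin
      rcases Nat.eq_zero_or_pos g with rfl | hg0
      · obtain ⟨z, -, h1, h2⟩ := hg u (Finset.mem_Icc.2 hmin.1) (by omega)
        omega
      -- The window starts at `u + 1` because a head at `u` itself may be the one that opens the
      -- segment.
      · obtain ⟨z, hz, h1, h2⟩ := hg (u + 1) (Finset.mem_Icc.2 (by omega)) (by omega)
        have := segIdx_lt_of_head hz (show u < z by omega) (show z ≤ t by omega)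
        omega
    simpa using Finset.card_le_card hsub

theorem segReward_le {P : Params} (S : Finset ℕ) {J : List Job} (hJ : IsInstance P J)
    (hv : 0 ≤ P.vmax) {n : ℕ} {A : Fin n → Mechanism} (hA : ∀ i, (A i).Feasible P) {g : ℕ}
    (hg : ∀ u ∈ Finset.Icc 1 P.T, u + g ≤ P.T + 1 → ∃ h ∈ S, u ≤ h ∧ h < u + g)
    (k : ℕ) (i : Fin n) : segReward P A S J k i ≤ g * (P.m * P.vmax) := by
  have hmv : 0 ≤ (P.m : ℝ) * P.vmax := by positivity
  refine (Finset.sum_le_card_nsmul _ _ (P.m * P.vmax) fun t _ => ?_).trans ?_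
  · split_ifs
    · exact hmv
    · exact welfareAt_le (isInstance_segment S hJ k) hv (hA i) t
  · rw [nsmul_eq_mul]
    gcongr
    exact card_segment_times_le S hg k

/-! ### Expectations over arms and coins -/

theorem sum_pmf_toReal {α : Type*} [Fintype α] (p : PMF α) : ∑ a, (p a).toReal = 1 := by
  rw [← ENNReal.toReal_sum fun a _ => p.apply_ne_top a,
    ← tsum_fintype (L := .unconditional _), p.tsum_coe, ENNReal.toReal_one]

theorem armExp_const {n K : ℕ} (p : PMF (Fin K → Fin n)) (x : ℝ) : armExp p (fun _ => x) = x := by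
  rw [armExp, ← Finset.sum_mul, sum_pmf_toReal, one_mul]

theorem armExp_mono {n K : ℕ} (p : PMF (Fin K → Fin n)) {f g : (Fin K → Fin n) → ℝ}
    (h : ∀ a, f a ≤ g a) : armExp p f ≤ armExp p g :=
  Finset.sum_le_sum fun a _ => mul_le_mul_of_nonneg_left (h a) ENNReal.toReal_nonneg

theorem coinExp_mono {T : ℕ} {γ : ℝ} (h0 : 0 ≤ γ) (h1 : γ ≤ 1) {f g : Finset ℕ → ℝ}
    (h : ∀ S ⊆ Finset.Icc 1 T, f S ≤ g S) : coinExp T γ f ≤ coinExp T γ g := by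
  have : 0 ≤ 1 - γ := by linarith
  exact Finset.sum_le_sum fun S hS =>
    mul_le_mul_of_nonneg_left (h S (Finset.mem_powerset.1 hS)) (by positivity)

theorem coinExp_add (T : ℕ) (γ : ℝ) (f g : Finset ℕ → ℝ) :
    coinExp T γ (fun S => f S + g S) = coinExp T γ f + coinExp T γ g := by
  simp only [coinExp, mul_add, Finset.sum_add_distrib]

theorem coinExp_sub (T : ℕ) (γ : ℝ) (f g : Finset ℕ → ℝ) :
    coinExp T γ (fun S => f S - g S) = coinExp T γ f - coinExp T γ g := by
  simp only [coinExp, mul_sub, Finset.sum_sub_distrib]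

theorem coinExp_const_mul (T : ℕ) (γ x : ℝ) (f : Finset ℕ → ℝ) :
    coinExp T γ (fun S => x * f S) = x * coinExp T γ f := by
  simp only [coinExp, Finset.mul_sum]
  exact Finset.sum_congr rfl fun S _ => by ring

theorem coinExp_sum {ι : Type*} (T : ℕ) (γ : ℝ) (s : Finset ι) (f : ι → Finset ℕ → ℝ) :
    coinExp T γ (fun S => ∑ i ∈ s, f i S) = ∑ i ∈ s, coinExp T γ (f i) := by
  simp only [coinExp, Finset.mul_sum]
  exact Finset.sum_comm

/-- The probability that no time of `I` shows heads. -/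
theorem coinExp_disjoint (T : ℕ) (γ : ℝ) {I : Finset ℕ} (hI : I ⊆ Finset.Icc 1 T) :
    coinExp T γ (fun S => if Disjoint S I then 1 else 0) = (1 - γ) ^ I.card := by
  -- In the expansion over subsets `S`, replacing the factor `γ` by `0` on `I` kills exactly the
  -- terms in which `S` meets `I`.
  have h := Finset.prod_add (fun i => if i ∈ I then 0 else γ) (fun _ => 1 - γ) (Finset.Icc 1 T)
  have hl : ∏ i ∈ Finset.Icc 1 T, ((if i ∈ I then 0 else γ) + (1 - γ)) = (1 - γ) ^ I.card := by
    rw [← Finset.prod_subset hI, Finset.prod_congr rfl (g := fun _ => 1 - γ), Finset.prod_const]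
    · intro i hi; simp [hi]
    · intro i _ hi; simp [hi]
  rw [← hl, h]
  refine Finset.sum_congr rfl fun S hS => ?_
  rw [Finset.mem_powerset] at hS
  rw [Finset.prod_const, Finset.card_sdiff_of_subset hS, Nat.card_Icc, Nat.add_sub_cancel]
  dsimp only
  by_cases hd : Disjoint S I
  · rw [if_pos hd, Finset.prod_congr rfl (g := fun _ => γ), Finset.prod_const, mul_one]
    intro i hi
    simp [Finset.disjoint_left.1 hd hi]
  · rw [if_neg hd]
    obtain ⟨i, hi, hiI⟩ := Finset.not_disjoint_iff.1 hd
    rw [Finset.prod_eq_zero hi (by simp [hiI])]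
    simp

theorem coinExp_one (T : ℕ) (γ : ℝ) : coinExp T γ (fun _ => 1) = 1 := by
  simpa using coinExp_disjoint T γ (Finset.empty_subset _)

theorem coinExp_const (T : ℕ) (γ x : ℝ) : coinExp T γ (fun _ => x) = x := by
  simpa [coinExp_one] using coinExp_const_mul T γ x fun _ => 1

theorem coinExp_card (T : ℕ) (γ : ℝ) : coinExp T γ (fun S => (S.card : ℝ)) = γ * T := by
  have h : coinExp T γ (fun S => (S.card : ℝ)) = coinExp T γ (fun S =>
      ∑ t ∈ Finset.Icc 1 T, (1 - if Disjoint S {t} then 1 else 0)) := by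
    refine Finset.sum_congr rfl fun S hS => ?_
    congr 1
    rw [Finset.mem_powerset] at hS
    calc (S.card : ℝ) = ∑ t ∈ Finset.Icc 1 T, if t ∈ S then 1 else 0 := by
          rw [Finset.sum_ite_mem, Finset.inter_eq_right.2 hS]; simp
      _ = _ := Finset.sum_congr rfl fun t _ => by
          by_cases ht : t ∈ S <;> simp [ht]
  rw [h, coinExp_sum, Finset.sum_congr rfl (g := fun _ => γ)]
  · simp [mul_comm]
  · intro t ht
    rw [coinExp_sub, coinExp_one, coinExp_disjoint T γ (by simpa using ht)]
    simp

/-! ### Regret -/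

theorem armExp_ftbs_ge {P : Params} {n : ℕ} {c R : ℝ} {A : Fin n → Mechanism} {B : BanditAlg n}
    (hB : B.HasRegret c) (S : Finset ℕ) {J : List Job} (hJ : IsInstance P J)
    (hR : ∀ k i, segReward P A S J k i ≤ R) (i : Fin n) :
    ∑ k : Fin (S.card + 1), segReward P A S J k i -
        armExp (ftbsArms P A B S J) (fun a => segmentedWelfare P S J fun x => A (a x)) ≤
      c * R * √(((S.card + 1 : ℕ) : ℝ) * n * Real.log n) := by
  have h := hB (S.card + 1) R (segReward P A S J)
    (fun k i => ⟨segReward_nonneg S hJ A k i, hR k i⟩) i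
  have hfb : ftbsFeedback P A S J = fun k a => segReward P A S J k (a (Fin.last k)) := by
    funext k a
    exact ftbsFeedback_eq A S hJ k a
  rw [← hfb] at h
  have h2 := armExp_mono (ftbsArms P A B S J) (fun a => sum_segReward_le S hJ A a)
  rw [ftbsArms] at h2 ⊢
  linarith

/-- The regret for fixed heads `S`. -/
theorem regret_of_heads_le {P : Params} (hv : 0 ≤ P.vmax) {n : ℕ} {c : ℝ}
    {A : Fin n → Mechanism} (hA : ∀ i, (A i).Feasible P) {B : BanditAlg n} (hB : B.HasRegret c)
    (S : Finset ℕ) {J : List Job} (hJ : IsInstance P J) (g : ℕ) (i : Fin n) :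
    segmentedWelfare P S J (fun _ => A i) -
        armExp (ftbsArms P A B S J) (fun a => segmentedWelfare P S J fun x => A (a x)) ≤
      P.m * P.vmax * ((P.L + 1) * (S.card + 1) +
        |c| * g * √((S.card + 1) * (n * Real.log n)) +
        P.T * ∑ u ∈ (Finset.Icc 1 P.T).filter (fun u => u + g ≤ P.T + 1),
          if Disjoint S (Finset.Ico u (u + g)) then 1 else 0) := by
  have hmv : 0 ≤ (P.m : ℝ) * P.vmax := by positivity
  -- If the heads hit every window, the bandit bound applies with range `g * (m * vmax)`. Otherwise
  -- the sum of indicators is at least `1`, and its weight `T` pays for the whole welfare of the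
  -- benchmark.
  by_cases hg : ∀ u ∈ Finset.Icc 1 P.T, u + g ≤ P.T + 1 → ∃ h ∈ S, u ≤ h ∧ h < u + g
  · have h1 := armExp_ftbs_ge hB S hJ (segReward_le S hJ hv hA hg) i
    have h2 := segmentedWelfare_le S hJ hv hA (fun _ => i)
    have h3 : c * (g * (P.m * P.vmax)) * √(((S.card + 1 : ℕ) : ℝ) * n * Real.log n) ≤
        |c| * (g * (P.m * P.vmax)) * √((S.card + 1) * (n * Real.log n)) := by
      rw [mul_assoc ((S.card + 1 : ℕ) : ℝ)]
      push_cast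
      gcongr
      exact le_abs_self c
    have h4 : 0 ≤ P.m * P.vmax * (P.T * ∑ u ∈ (Finset.Icc 1 P.T).filter
        (fun u => u + g ≤ P.T + 1), if Disjoint S (Finset.Ico u (u + g)) then (1 : ℝ) else 0) := by
      refine mul_nonneg hmv (mul_nonneg (by positivity) (Finset.sum_nonneg fun u _ => ?_))
      split_ifs <;> norm_num
    linarith
  · push Not at hg
    obtain ⟨u, hu, hug, hS⟩ := hg
    have hd : Disjoint S (Finset.Ico u (u + g)) := by
      rw [Finset.disjoint_left]
      intro h hh hI
      rw [Finset.mem_Ico] at hI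
      exact absurd (hS h hh hI.1) (not_le.2 hI.2)
    have h1 : (1 : ℝ) ≤ ∑ u ∈ (Finset.Icc 1 P.T).filter
        (fun u => u + g ≤ P.T + 1), if Disjoint S (Finset.Ico u (u + g)) then (1 : ℝ) else 0 := by
      refine le_trans (by rw [if_pos hd]) (Finset.single_le_sum (a := u)
        (f := fun u => if Disjoint S (Finset.Ico u (u + g)) then (1 : ℝ) else 0) ?_ ?_)
      · intro u _; split_ifs <;> norm_num
      · exact Finset.mem_filter.2 ⟨hu, hug⟩
    have h2 := segmentedWelfare_le_horizon S hJ hv (A := fun _ => A i) (fun _ => hA i)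
    have h3 : 0 ≤ armExp (ftbsArms P A B S J)
        (fun a => segmentedWelfare P S J fun x => A (a x)) :=
      Finset.sum_nonneg fun a _ => mul_nonneg ENNReal.toReal_nonneg
        (segmentedWelfare_nonneg S hJ _)
    have h4 : 0 ≤ P.m * P.vmax * ((P.L + 1) * (S.card + 1) +
        |c| * g * √((S.card + 1) * (n * Real.log n))) := by positivity
    have h5 : P.m * P.vmax * (P.T * 1) ≤ P.m * P.vmax * (P.T * ∑ u ∈ (Finset.Icc 1 P.T).filter
        (fun u => u + g ≤ P.T + 1),
          if Disjoint S (Finset.Ico u (u + g)) then (1 : ℝ) else 0) := by gcongr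
    linarith

/-- The expected regret for a window length `g` and a positive scale `Y`. -/
theorem expected_regret_le {P : Params} (hv : 0 ≤ P.vmax) {n : ℕ} {c γ : ℝ}
    (h0 : 0 ≤ γ) (h1 : γ ≤ 1) {A : Fin n → Mechanism} (hA : ∀ i, (A i).Feasible P)
    {B : BanditAlg n} (hB : B.HasRegret c) {J : List Job} (hJ : IsInstance P J) (g : ℕ)
    {Y : ℝ} (hY : 0 < Y) (i : Fin n) :
    coinExp P.T γ (fun S => segmentedWelfare P S J fun _ => A i) - ftbsWelfare P γ A B J ≤
      P.m * P.vmax * ((P.L + 1) * (γ * P.T + 1) +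
        |c| * g * (((γ * P.T + 1) * (n * Real.log n) / Y + Y) / 2) +
        P.T * (P.T * (1 - γ) ^ g)) := by
  have hmv : 0 ≤ (P.m : ℝ) * P.vmax := by positivity
  have hq : 0 ≤ (n : ℝ) * Real.log n := mul_nonneg (by positivity) (Real.log_natCast_nonneg n)
  have h1γ : 0 ≤ 1 - γ := by linarith
  rw [ftbsWelfare, ← coinExp_sub]
  have key : ∀ S ⊆ Finset.Icc 1 P.T, segmentedWelfare P S J (fun _ => A i) -
      armExp (ftbsArms P A B S J) (fun a => segmentedWelfare P S J fun x => A (a x)) ≤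
      P.m * P.vmax * ((P.L + 1) * (S.card + 1) +
        |c| * g * ((n * Real.log n / Y / 2) * (S.card + 1) + Y / 2) +
        P.T * ∑ u ∈ (Finset.Icc 1 P.T).filter (fun u => u + g ≤ P.T + 1),
          if Disjoint S (Finset.Ico u (u + g)) then 1 else 0) := by
    intro S _
    refine (regret_of_heads_le hv hA hB S hJ g i).trans ?_
    gcongr
    set x : ℝ := (S.card + 1) * (n * Real.log n)
    have hx : 0 ≤ x := by positivity
    have e : n * Real.log n / Y / 2 * (S.card + 1) + Y / 2 = (x + Y ^ 2) / (2 * Y) := by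
      simp only [x]; field_simp
    rw [e, le_div_iff₀ (by positivity)]
    -- AM-GM, `√x ≤ (x / Y + Y) / 2`: the bound becomes affine in `S.card`, so its expectation needs
    -- only the mean number of heads.
    nlinarith [Real.sq_sqrt hx, sq_nonneg (√x - Y)]
  refine (coinExp_mono h0 h1 key).trans ?_
  simp only [coinExp_const_mul, coinExp_add, coinExp_sum, coinExp_card, coinExp_const]
  have hsum : ∑ u ∈ (Finset.Icc 1 P.T).filter (fun u => u + g ≤ P.T + 1),
      coinExp P.T γ (fun S => if Disjoint S (Finset.Ico u (u + g)) then 1 else 0) ≤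
      P.T * (1 - γ) ^ g := by
    refine (Finset.sum_le_card_nsmul _ _ ((1 - γ) ^ g) fun u hu => ?_).trans ?_
    · simp only [Finset.mem_filter, Finset.mem_Icc] at hu
      rw [coinExp_disjoint]
      · simp
      · intro t ht
        simp only [Finset.mem_Ico, Finset.mem_Icc] at ht ⊢
        omega
    · rw [nsmul_eq_mul]
      gcongr
      exact (Finset.card_filter_le _ _).trans (by simp)
  have e : n * Real.log n / Y / 2 * (γ * P.T + 1) + Y / 2 =
      ((γ * P.T + 1) * (n * Real.log n) / Y + Y) / 2 := by ring
  rw [e]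
  gcongr

theorem expected_regret_le_horizon {P : Params} (hv : 0 ≤ P.vmax) {n : ℕ} {γ : ℝ}
    (h0 : 0 ≤ γ) (h1 : γ ≤ 1) {A : Fin n → Mechanism} (hA : ∀ i, (A i).Feasible P)
    (B : BanditAlg n) {J : List Job} (hJ : IsInstance P J) (i : Fin n) :
    coinExp P.T γ (fun S => segmentedWelfare P S J fun _ => A i) - ftbsWelfare P γ A B J ≤
      P.T * (P.m * P.vmax) := by
  rw [ftbsWelfare, ← coinExp_sub, ← coinExp_const P.T γ (P.T * (P.m * P.vmax))]
  refine coinExp_mono h0 h1 fun S _ => ?_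
  have h2 := segmentedWelfare_le_horizon S hJ hv (A := fun _ => A i) (fun _ => hA i)
  have h3 : 0 ≤ armExp (ftbsArms P A B S J)
      (fun a => segmentedWelfare P S J fun x => A (a x)) :=
    Finset.sum_nonneg fun a _ => mul_nonneg ENNReal.toReal_nonneg
      (segmentedWelfare_nonneg S hJ _)
  linarith

/-- For `n = 1` the claimed bound is `0` because `log 1 = 0`, so equality is needed rather than an
estimate. -/
theorem ftbsWelfare_eq_of_subsingleton (P : Params) (γ : ℝ) (A : Fin 1 → Mechanism)
    (B : BanditAlg 1) (J : List Job) (i : Fin 1) :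
    ftbsWelfare P γ A B J = coinExp P.T γ fun S => segmentedWelfare P S J fun _ => A i := by
  unfold ftbsWelfare
  congr 1
  funext S
  rw [show (fun a : Fin (S.card + 1) → Fin 1 => segmentedWelfare P S J fun x => A (a x)) =
    fun _ => segmentedWelfare P S J fun _ => A i from
      funext fun a => by congr 1; funext x; rw [Subsingleton.elim (a x) i]]
  exact armExp_const _ _

/-- The choice of the parameters: with `γ = q^{1/3} / (L^{2/3} T^{1/3})` and
`X = L^{1/3} q^{1/3} T^{2/3}`, one has `γ L T = X` and `q T = γ X²`. -/
theorem regret_bound_of_params {L T q γ c X : ℝ} (hL : 1 ≤ L) (hLT : L ≤ T) (hT : 2 ≤ T)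
    (hq : 1 ≤ q) (hγ0 : 0 < γ) (hγ1 : γ ≤ 1) (hX : 1 ≤ X) (e1 : γ * L * T = X)
    (e2 : q * T = γ * X ^ 2) :
    (L + 1) * (γ * T + 1) +
        |c| * ⌈2 * Real.log T / γ⌉₊ * (((γ * T + 1) * q / (γ * X) + γ * X) / 2) +
        T * (T * (1 - γ) ^ ⌈2 * Real.log T / γ⌉₊) ≤ (10 + 6 * |c|) * (X * Real.log T) := by
  have hlog : 1 / 2 ≤ Real.log T :=
    le_trans (by linarith [Real.log_two_gt_d9]) (Real.log_le_log (by norm_num) hT)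
  have hT0 : 0 < T := by linarith
  have hL0 : 0 < L := by linarith
  have hX0 : 0 < X := by linarith
  -- If `γ T < 1`, then `X < L ≤ T`, hence `q T = γ X² ≤ γ L T = X < T`, against `q ≥ 1`. This lets
  -- `γ T + 1` be replaced by `2 γ T`.
  have hγT : 1 ≤ γ * T := by
    by_contra! h
    have h1 : X < L := by rw [← e1]; nlinarith
    have h2 : γ * X ^ 2 < T := by
      calc γ * X ^ 2 ≤ γ * (L * T) := by
            gcongr
            nlinarith
        _ = X := by rw [← e1]; ring
        _ < T := by linarith
    nlinarith
  set g : ℕ := ⌈2 * Real.log T / γ⌉₊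
  have hg1 : 2 * Real.log T ≤ γ * g := by
    have := Nat.le_ceil (2 * Real.log T / γ)
    rw [div_le_iff₀ hγ0] at this
    linarith
  -- Rounding up adds at most `γ ≤ 1 ≤ 2 log T`.
  have hg2 : γ * g ≤ 4 * Real.log T := by
    have h := (Nat.ceil_lt_add_one (show 0 ≤ 2 * Real.log T / γ by positivity)).le
    have h2 : γ * g ≤ γ * (2 * Real.log T / γ + 1) := by gcongr
    have h3 : γ * (2 * Real.log T / γ + 1) = 2 * Real.log T + γ := by field_simp
    linarith
  have hA : (L + 1) * (γ * T + 1) ≤ 4 * X := by rw [← e1]; nlinarith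
  have hB : ((γ * T + 1) * q / (γ * X) + γ * X) / 2 ≤ 3 / 2 * (γ * X) := by
    have : (γ * T + 1) * q / (γ * X) ≤ 2 * (γ * X) := by
      rw [div_le_iff₀ (by positivity)]
      have : (γ * T + 1) * q ≤ 2 * γ * (q * T) := by nlinarith
      rw [e2] at this
      linarith
    linarith
  have hC : T * (T * (1 - γ) ^ g) ≤ 1 := by
    have h1 : (1 - γ) ^ g ≤ (T ^ 2)⁻¹ := by
      calc (1 - γ) ^ g ≤ Real.exp (-γ) ^ g := by
            have : 0 ≤ 1 - γ := by linarith
            gcongr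
            exact Real.one_sub_le_exp_neg γ
        _ = Real.exp (-(γ * g)) := by rw [← Real.exp_nat_mul]; ring_nf
        _ ≤ Real.exp (-(2 * Real.log T)) := by gcongr
        _ = (T ^ 2)⁻¹ := by
            rw [Real.exp_neg, ← Nat.cast_ofNat, Real.exp_nat_mul, Real.exp_log hT0]
    calc T * (T * (1 - γ) ^ g) ≤ T * (T * (T ^ 2)⁻¹) := by gcongr
      _ = 1 := by field_simp
  have hD : |c| * g * (((γ * T + 1) * q / (γ * X) + γ * X) / 2) ≤
      6 * |c| * (X * Real.log T) := by
    calc _ ≤ |c| * g * (3 / 2 * (γ * X)) := by gcongr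
      _ = |c| * (3 / 2) * X * (γ * g) := by ring
      _ ≤ |c| * (3 / 2) * X * (4 * Real.log T) := by gcongr
      _ = _ := by ring
  -- As `log T ≥ 1/2` and `X ≥ 1`, the terms `4 X` and `1` are at most `8 X log T` and `2 X log T`,
  -- which gives the `10`.
  nlinarith

end Sched

/-! ### Tuned restart probability and degenerate cases -/

theorem mainTheorem2 (c : ℝ) :
    ∃ C : ℝ, ∀ (P : Sched.Params) (n : ℕ), 1 ≤ n → 2 ≤ P.T → 1 ≤ P.lmax + P.dmax → 0 ≤ P.vmax →
      Sched.restartProb P n ≤ 1 →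
      ∀ A : Fin n → Sched.Mechanism, (∀ i, (A i).Feasible P) →
      ∀ B : Sched.BanditAlg n, B.HasRegret c →
      ∀ J : List Sched.Job, Sched.IsInstance P J →
        Sched.benchmark P (Sched.restartProb P n) A J -
            Sched.ftbsWelfare P (Sched.restartProb P n) A B J ≤
          C * ((P.m : ℝ) * P.vmax * ((P.lmax : ℝ) + P.dmax) ^ (1 / 3 : ℝ) *
            ((n : ℝ) * Real.log n) ^ (1 / 3 : ℝ) * (P.T : ℝ) ^ (2 / 3 : ℝ) *
            Real.log P.T) := by
  refine ⟨10 + 6 * |c|, fun P n hn hT hL hv hγ1 A hA B hB J hJ => ?_⟩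
  have hmv : 0 ≤ (P.m : ℝ) * P.vmax := by positivity
  have : Nonempty (Fin n) := ⟨⟨0, hn⟩⟩
  rw [sub_le_iff_le_add]
  refine ciSup_le fun i => ?_
  rw [← sub_le_iff_le_add]
  have hTr : (2 : ℝ) ≤ P.T := by exact_mod_cast hT
  rcases Nat.lt_or_ge 1 n with hn2 | hn1
  · have hLr : (1 : ℝ) ≤ P.L := by exact_mod_cast hL
    have hLe : (P.lmax : ℝ) + P.dmax = P.L := by simp [Sched.Params.L]
    have hlog : 1 / 2 ≤ Real.log P.T :=
      le_trans (by linarith [Real.log_two_gt_d9]) (Real.log_le_log (by norm_num) hTr)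
    have hq : 1 ≤ (n : ℝ) * Real.log n := by
      have h2 : (2 : ℝ) ≤ n := by exact_mod_cast hn2
      have h3 : 1 / 2 ≤ Real.log n :=
        le_trans (by linarith [Real.log_two_gt_d9]) (Real.log_le_log (by norm_num) h2)
      nlinarith
    have hγe : Sched.restartProb P n = (P.L : ℝ) ^ (-(2 / 3) : ℝ) * (P.T : ℝ) ^ (-(1 / 3) : ℝ) *
        ((n : ℝ) * Real.log n) ^ (1 / 3 : ℝ) := rfl
    set γ := Sched.restartProb P n
    rw [hLe]
    set L : ℝ := (P.L : ℝ)
    set T : ℝ := (P.T : ℝ)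
    set q : ℝ := n * Real.log n with hqdef
    have hL0 : 0 < L := by linarith
    have hT0 : 0 < T := by linarith
    have hq0 : 0 < q := by linarith
    have hγ0 : 0 < γ := by rw [hγe]; positivity
    set X : ℝ := L ^ (1 / 3 : ℝ) * q ^ (1 / 3 : ℝ) * T ^ (2 / 3 : ℝ) with hXdef
    have hgoal : (P.m : ℝ) * P.vmax * L ^ (1 / 3 : ℝ) * q ^ (1 / 3 : ℝ) * T ^ (2 / 3 : ℝ) *
        Real.log T = P.m * P.vmax * (X * Real.log T) := by rw [hXdef]; ring
    have hp : ∀ x : ℝ, 0 < x → (x ^ (1 / 3 : ℝ)) ^ 3 = x := fun x hx => by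
      rw [← Real.rpow_natCast, ← Real.rpow_mul hx.le]; norm_num
    have hp2 : ∀ x : ℝ, 0 < x → x ^ (2 / 3 : ℝ) = (x ^ (1 / 3 : ℝ)) ^ 2 := fun x hx => by
      rw [← Real.rpow_natCast, ← Real.rpow_mul hx.le]; norm_num
    rw [hgoal]
    have hX1 : 1 ≤ X := by
      have h1 := Real.one_le_rpow hLr (show (0 : ℝ) ≤ 1 / 3 by norm_num)
      have h2 := Real.one_le_rpow hq (show (0 : ℝ) ≤ 1 / 3 by norm_num)
      have h3 := Real.one_le_rpow (show 1 ≤ T by linarith) (show (0 : ℝ) ≤ 2 / 3 by norm_num)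
      exact one_le_mul_of_one_le_of_one_le (one_le_mul_of_one_le_of_one_le h1 h2) h3
    rcases le_total L T with hLT | hTL
    · have hγe2 : γ = q ^ (1 / 3 : ℝ) / ((L ^ (1 / 3 : ℝ)) ^ 2 * T ^ (1 / 3 : ℝ)) := by
        rw [hγe, Real.rpow_neg hL0.le, Real.rpow_neg hT0.le, hp2 L hL0]
        field_simp
      have hXe : X = L ^ (1 / 3 : ℝ) * q ^ (1 / 3 : ℝ) * (T ^ (1 / 3 : ℝ)) ^ 2 := by
        rw [hXdef, hp2 T hT0]
      have hl : 0 < L ^ (1 / 3 : ℝ) := by positivity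
      have ht : 0 < T ^ (1 / 3 : ℝ) := by positivity
      have hqq : 0 < q ^ (1 / 3 : ℝ) := by positivity
      have e1 : γ * L * T = X := by
        rw [hγe2, hXe]
        nth_rewrite 2 [← hp L hL0]
        nth_rewrite 2 [← hp T hT0]
        field_simp
      have e2 : q * T = γ * X ^ 2 := by
        rw [hγe2, hXe]
        nth_rewrite 1 [← hp q hq0]
        nth_rewrite 1 [← hp T hT0]
        field_simp
      -- `Y = γ X` is the AM-GM optimum up to a constant, since `γ T q = (γ X)²`.
      have h := Sched.expected_regret_le hv hγ0.le hγ1 hA hB hJ ⌈2 * Real.log T / γ⌉₊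
        (show 0 < γ * X by positivity) i
      refine (h.trans (mul_le_mul_of_nonneg_left
        (Sched.regret_bound_of_params hLr hLT hTr hq hγ0 hγ1 hX1 e1 e2) hmv)).trans_eq ?_
      ring
    -- For `L ≥ T` the trivial regret bound suffices: `T = T^{1/3} T^{2/3} ≤ X`.
    · refine (Sched.expected_regret_le_horizon hv hγ0.le hγ1 hA B hJ i).trans ?_
      have hTX : T ≤ X := by
        calc T = T ^ (1 / 3 : ℝ) * 1 * T ^ (2 / 3 : ℝ) := by
              rw [hp2 T hT0, mul_one, ← pow_succ', hp T hT0]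
          _ ≤ X := by
              rw [hXdef]
              gcongr
              exact Real.one_le_rpow hq (by norm_num)
      have hfin : T ≤ (10 + 6 * |c|) * (X * Real.log T) := by
        have h1 : X * (1 / 2) ≤ X * Real.log T := by gcongr
        have h2 : 0 ≤ |c| * (X * Real.log T) := by positivity
        nlinarith
      calc T * (P.m * P.vmax) ≤ (10 + 6 * |c|) * (X * Real.log T) * (P.m * P.vmax) := by gcongr
        _ = _ := by ring
  · obtain rfl : n = 1 := by omega
    rw [Sched.ftbsWelfare_eq_of_subsingleton _ _ _ _ _ i]
    simp
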